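/- Let $L$ be a first-order language, $\kappa$ an infinite cardinal, and $\mathfrak C$ a $\kappa$-saturated and strongly $\kappa$-homogeneous $L$-structure. For $\lambda<\kappa$, a subset $X\subseteq\mathfrak C^\lambda$ is $\emptyset$-type-definable if it is the set of realizations of a set of $L$-formulas without parameters; an equivalence relation $E$ on such an $X$ is $\emptyset$-type-definable if it is the restriction to $X\times X$ of a $\emptyset$-type-definable set; then $X/E$ is called a hyperdefinable set. Two tuples of elements of $X/E$ and of $\mathfrak C$ (of length $<\kappa$) have the same type, written $\operatorname{tp}(u)=\operatorname{tp}(v)$, if some automorphism of $\mathfrak C$ maps $u$ to $v$. A sequence $(u_i)_{i<\omega}$ is indiscernible if $\operatorname{tp}(u_{i_1},\dots,u_{i_n})=\operatorname{tp}(u_{j_1},\dots,u_{j_n})$ for all $n$, $i_1<\dots<i_n$ and $j_1<\dots<j_n$. The hyperdefinable set $X/E$ is stable if for every indiscernible sequence $(a_i,b_i)_{i<\omega}$, where $a_i\in X/E$ and the $b_i$ are tuples from $\mathfrak C$ of some common length less than $\kappa$, we have $\operatorname{tp}(a_i,b_j)=\operatorname{tp}(a_j,b_i)$ for all $i\ne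 j$. 1. Let $X\subseteq\mathfrak C^{\lambda}$ and $Y\subseteq\mathfrak C^{\mu}$ with $\lambda,\mu<\kappa$. If $X/E$ and $Y/F$ are stable hyperdefinable sets, then $X/E\times Y/F$ (that is, the quotient of $X\times Y\subseteq\mathfrak C^{\lambda+\mu}$ by the relation "$x\mathrel{E}x'$ and $y\mathrel{F}y'$") is a stable hyperdefinable set. 2. Let $X\subseteq\mathfrak C^\lambda$, $\lambda<\kappa$, be $\emptyset$-type-definable. The intersection of an arbitrary family of $\emptyset$-type-definable equivalence relations on $X$ with stable quotients is a $\emptyset$-type-definable equivalence relation on $X$ with stable quotient. In particular, there exists a finest $\emptyset$-type-definable equivalence relation on $X$ with stable quotient. -/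

import Mathlib

open FirstOrder Cardinal

universe u u₁ u₂

namespace Hyperdef

/-- `M` is `κ`-saturated: for every set `A` of fewer than `κ` parameters, every set of formulas
over `A` in finitely many variables that is finitely satisfiable in `M` (that is, consistent with
the elementary diagram of `M`) is realized in `M`. -/
def IsSaturated (L : FirstOrder.Language.{u₁, u₂}) (M : Type u) [L.Structure M] (κ : Cardinal.{u}) : Prop :=
  ∀ A : Set M, #A < κ → ∀ (n : ℕ) (p : Set ((L.withConstants A).Formula (Fin n))),
    (∀ s : Finset ((L.withConstants A).Formula (Fin n)), (s : Set _) ⊆ p →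
      ∃ v : Fin n → M, ∀ φ ∈ s, φ.Realize v) →
    ∃ v : Fin n → M, ∀ φ ∈ p, φ.Realize v

/-- `M` is strongly `κ`-homogeneous: every partial elementary map defined on a subset with fewer
than `κ` elements extends to an automorphism of `M`. -/
def IsStronglyHomogeneous (L : FirstOrder.Language.{u₁, u₂}) (M : Type u) [L.Structure M]
    (κ : Cardinal.{u}) : Prop :=
  ∀ A : Set M, #A < κ → ∀ f : A → M,
    (∀ φ : L.Formula A, φ.Realize (fun a : A => (a : M)) ↔ φ.Realize f) →
    ∃ σ : M ≃[L] M, ∀ a : A, σ (a : M) = f a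

/-- `X ⊆ M ^ α` is `∅`-type-definable: it is the set of realizations of a partial type without
parameters. -/
def IsTypeDefinable (L : FirstOrder.Language.{u₁, u₂}) {M : Type u} [L.Structure M] {α : Type u}
    (X : Set (α → M)) : Prop :=
  ∃ π : Set (L.Formula α), ∀ x : α → M, x ∈ X ↔ ∀ φ ∈ π, φ.Realize x

/-- The equivalence relation `E` on `X ⊆ M ^ α` is `∅`-type-definable: on `X × X` it is given by a
partial type `ρ(x, y)` without parameters. -/
def IsTypeDefinableRel (L : FirstOrder.Language.{u₁, u₂}) {M : Type u} [L.Structure M] {α : Type u}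
    {X : Set (α → M)} (E : Setoid X) : Prop :=
  ∃ ρ : Set (L.Formula (α ⊕ α)), ∀ x y : X,
    E x y ↔ ∀ φ ∈ ρ, φ.Realize (Sum.elim (x : α → M) (y : α → M))

/-- `X / E` is a hyperdefinable set (over `∅`). -/
def IsHyperdefinable (L : FirstOrder.Language.{u₁, u₂}) {M : Type u} [L.Structure M] {α : Type u}
    {X : Set (α → M)} (E : Setoid X) : Prop :=
  IsTypeDefinable L X ∧ IsTypeDefinableRel L E

/-- `σ (x / E) = y / E`, for an automorphism `σ` and hyperimaginaries `x / E` and `y / E`, which are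
given by representatives. (If `X` is type-definable, then `σ ∘ x ∈ X` holds automatically.) -/
def MapsClass (L : FirstOrder.Language.{u₁, u₂}) {M : Type u} [L.Structure M] {α : Type u}
    {X : Set (α → M)} (E : Setoid X) (σ : M ≃[L] M) (x y : X) : Prop :=
  ∃ h : σ ∘ (x : α → M) ∈ X, E ⟨σ ∘ (x : α → M), h⟩ y

/-- `tp ((x k / E, b k) : k ∈ ι) = tp ((x' k / E, b' k) : k ∈ ι)`: the two families of pairs, each
consisting of a hyperimaginary from `X / E` and a tuple from `M ^ γ`, lie in the same orbit of the
automorphism group of `M`. -/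
def EqType (L : FirstOrder.Language.{u₁, u₂}) {M : Type u} [L.Structure M] {α : Type u}
    {X : Set (α → M)} (E : Setoid X) {ι : Type} {γ : Type u}
    (x : ι → X) (b : ι → γ → M) (x' : ι → X) (b' : ι → γ → M) : Prop :=
  ∃ σ : M ≃[L] M, ∀ k : ι, MapsClass L E σ (x k) (x' k) ∧ σ ∘ b k = b' k

/-- The sequence `(a i / E, b i)`, `i < ω`, is indiscernible. -/
def IsIndiscernible (L : FirstOrder.Language.{u₁, u₂}) {M : Type u} [L.Structure M] {α : Type u}
    {X : Set (α → M)} (E : Setoid X) {γ : Type u} (a : ℕ → X) (b : ℕ → γ → M) : Prop :=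
  ∀ (n : ℕ) (i j : Fin n → ℕ), StrictMono i → StrictMono j →
    EqType L E (a ∘ i) (b ∘ i) (a ∘ j) (b ∘ j)

/-- `X / E` is stable, where `κ` is the degree of saturation of `M`: for every indiscernible sequence
`(a i / E, b i)`, `i < ω`, with `a i / E` in `X / E` and `b i` a tuple from `M` of an arbitrary
length `γ < κ`, one has `tp (a i / E, b j) = tp (a j / E, b i)` for all `i ≠ j`. -/
def IsStable (L : FirstOrder.Language.{u₁, u₂}) {M : Type u} [L.Structure M] (κ : Cardinal.{u}) {α : Type u}
    {X : Set (α → M)} (E : Setoid X) : Prop :=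
  ∀ γ : Type u, #γ < κ → ∀ (a : ℕ → X) (b : ℕ → γ → M), IsIndiscernible L E a b →
    ∀ i j : ℕ, i ≠ j →
      EqType L E (fun _ : Unit => a i) (fun _ => b j) (fun _ : Unit => a j) (fun _ => b i)

/-- The Cartesian product `X × Y`, as a subset of `M ^ (α ⊕ β)`. -/
def prodSet {M α β : Type u} (X : Set (α → M)) (Y : Set (β → M)) : Set (α ⊕ β → M) :=
  {z | z ∘ Sum.inl ∈ X ∧ z ∘ Sum.inr ∈ Y}

/-- The equivalence relation on `X × Y` whose quotient is `X / E × Y / F`: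
`(x, y) ∼ (x', y')` if and only if `E x x'` and `F y y'`. -/
def prodRel {M α β : Type u} {X : Set (α → M)} {Y : Set (β → M)} (E : Setoid X) (F : Setoid Y) :
    Setoid (prodSet X Y) :=
  (E.prod F).comap fun z => (⟨(z : α ⊕ β → M) ∘ Sum.inl, z.2.1⟩, ⟨(z : α ⊕ β → M) ∘ Sum.inr, z.2.2⟩)

end Hyperdef

namespace Hyperdef

/-! ### Finite support and elimination of infinite blocks of existential quantifiers. -/

section Formulas

variable {L : FirstOrder.Language.{u₁, u₂}} {M : Type u} [L.Structure M]

/-! Types are orbits, hence equal or disjoint. So for an indiscernible sequence in the product it is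
enough that the realization sets D of tp(a_i, b_j) and D' of tp(a_j, b_i), i < j, have a common
point. Extract from representatives an order-indiscernible sequence of terms (x_k, y_k, b_k).
Stability of X/E makes the type of the class of x_n over N other terms independent of its position
(`IsStable.exists_equiv_skip`): for n < N, some automorphism takes the class of x_n to that of x_N
and the terms other than the n-th, in order, to the terms 0, ..., N - 1. Let y'_n be the image of
y_n. Then (x_N, y'_n, b_t) lies in D for n < t < N and in D' for t < n. With x_N fixed and moved to
the parameter side, this is a half-graph of length N between Y/F and the tuples (b_t, x_N). As N is
arbitrary, compactness and stability of Y/F yield a point of D ∩ D' (`IsStable.inter_nonempty`). For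
intersections, X/(E ⊓ F) embeds diagonally in X/E × X/F, which settles finite families;
`isStable_sInf` passes to arbitrary ones by saturation. The finest relation is the infimum of all
candidates. -/

theorem exists_finset_support {β : Type*} (φ : L.Formula β) :
    ∃ s : Finset β, ∀ v w : β → M, (∀ b ∈ s, v b = w b) → (φ.Realize v ↔ φ.Realize w) := by
  classical
  refine ⟨φ.freeVarFinset, fun v w h => ?_⟩
  have h1 := FirstOrder.Language.BoundedFormula.realize_restrictFreeVar (φ := φ) (f := id)
    (v := fun a => v a) (xs := default) v (fun a => rfl)
  have h2 := FirstOrder.Language.BoundedFormula.realize_restrictFreeVar (φ := φ) (f := id)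
    (v := fun a => v a) (xs := default) w (fun a => h _ a.2)
  exact h1.symm.trans h2

/-- `V` may be infinite, so one quantifies only over its finitely many members occurring in `φ`; the
others get an arbitrary value. -/
theorem exists_formula_exists [Nonempty M] {β V : Type*} (φ : L.Formula (β ⊕ V)) :
    ∃ ψ : L.Formula β, ∀ b : β → M, ψ.Realize b ↔ ∃ w : V → M, φ.Realize (Sum.elim b w) := by
  classical
  let s : Set V := {v | Sum.inr v ∈ φ.freeVarFinset}
  have hs : s.Finite := φ.freeVarFinset.finite_toSet.preimage Sum.inr_injective.injOn
  have : Finite s := hs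
  let f : φ.freeVarFinset → β ⊕ s := fun x => match x with
    | ⟨Sum.inl b, _⟩ => Sum.inl b
    | ⟨Sum.inr v, h⟩ => Sum.inr ⟨v, h⟩
  let χ : L.Formula (β ⊕ s) := FirstOrder.Language.BoundedFormula.restrictFreeVar φ f
  have key : ∀ (b : β → M) (i : s → M) (w : V → M), (∀ v, i v = w v) →
      (χ.Realize (Sum.elim b i) ↔ φ.Realize (Sum.elim b w)) := by
    intro b i w h
    refine FirstOrder.Language.BoundedFormula.realize_restrictFreeVar (Sum.elim b w) ?_
    rintro ⟨b | v, hv⟩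
    · rfl
    · exact h ⟨v, hv⟩
  refine ⟨χ.iExs s, fun b => ?_⟩
  rw [FirstOrder.Language.Formula.realize_iExs]
  constructor
  · rintro ⟨i, hi⟩
    refine ⟨fun v => if h : v ∈ s then i ⟨v, h⟩ else Classical.arbitrary M, ?_⟩
    exact (key b i _ fun v => by simp).1 hi
  · rintro ⟨w, hw⟩
    exact ⟨fun v => w v, (key b _ w fun v => rfl).2 hw⟩

theorem exists_formula_forall_mem {β : Type*} (s : Finset (L.Formula β)) :
    ∃ ψ : L.Formula β, ∀ v : β → M, ψ.Realize v ↔ ∀ φ ∈ s, φ.Realize v :=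
  ⟨FirstOrder.Language.Formula.iInf fun φ : s => (φ : L.Formula β), fun v => by simp⟩

theorem exists_formula_withConstants_exists [Nonempty M] {V : Type*} {A : Set M} {n : ℕ}
    (φ : L.Formula ((A ⊕ Fin n) ⊕ V)) :
    ∃ ψ : (L.withConstants A).Formula (Fin n), ∀ x : Fin n → M,
      ψ.Realize x ↔ ∃ w : V → M, φ.Realize (Sum.elim (Sum.elim (fun a : A => (a : M)) x) w) := by
  obtain ⟨χ, hχ⟩ := exists_formula_exists (M := M) φ
  refine ⟨FirstOrder.Language.BoundedFormula.constantsVarsEquiv.symm χ, fun x => ?_⟩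
  rw [← hχ]
  unfold FirstOrder.Language.Formula.Realize
  rw [← FirstOrder.Language.BoundedFormula.realize_constantsVarsEquiv, Equiv.apply_symm_apply]
  rfl

end Formulas

/-! ### Realizing types in up to κ variables. -/

section Saturation

variable {L : FirstOrder.Language.{u₁, u₂}} {M : Type u} [L.Structure M] {κ : Cardinal.{u}}

/-- `f` on `I` extends to solutions of all finite subsets of `Γ`. -/
def ExtendsFinitely {P V : Type u} (p : P → M) (Γ : Set (L.Formula (P ⊕ V))) (I : Set V)
    (f : V → M) : Prop :=
  ∀ s : Finset (L.Formula (P ⊕ V)), (s : Set _) ⊆ Γ →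
    ∃ w : V → M, Set.EqOn w f I ∧ ∀ φ ∈ s, φ.Realize (Sum.elim p w)

/-- The admissible values at `v` are cut out by formulas in one variable over the fewer than κ
parameters in `p` and `f '' I`, one for each finite subset of `Γ`. Finitely many of them hold
together because the union of the subsets is again finite. -/
theorem ExtendsFinitely.exists_update [Nonempty M] (hκ : ℵ₀ ≤ κ) (hsat : IsSaturated L M κ)
    {P V : Type u} [DecidableEq V] {p : P → M} {Γ : Set (L.Formula (P ⊕ V))} {I : Set V} {f : V → M}
    (h : ExtendsFinitely p Γ I f) (hP : #P < κ) (hI : #I < κ) {v : V} (hv : v ∉ I) :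
    ∃ m : M, ExtendsFinitely p Γ (insert v I) (Function.update f v m) := by
  classical
  let A : Set M := Set.range p ∪ f '' I
  have hA : #A < κ := (mk_union_le _ _).trans_lt
    (add_lt_of_lt hκ (mk_range_le.trans_lt hP) (mk_image_le.trans_lt hI))
  let Q (s : Finset (L.Formula (P ⊕ V))) (m : M) : Prop :=
    ∃ w : V → M, Set.EqOn w f I ∧ w v = m ∧ ∀ φ ∈ s, φ.Realize (Sum.elim p w)
  have hQ (s) : ∃ ψ : (L.withConstants A).Formula (Fin 1), ∀ x : Fin 1 → M,
      ψ.Realize x ↔ Q s (x 0) := by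
    obtain ⟨θ, hθ⟩ := exists_formula_forall_mem (M := M) s
    -- Parameters and variables in `I` become constants, `v` becomes the free variable, and the rest
    -- is left to be quantified.
    let g : P ⊕ V → (A ⊕ Fin 1) ⊕ V := Sum.elim
      (fun q => Sum.inl (Sum.inl ⟨p q, Or.inl ⟨q, rfl⟩⟩))
      (fun u => if hu : u ∈ I then Sum.inl (Sum.inl ⟨f u, Or.inr ⟨u, hu, rfl⟩⟩)
        else if u = v then Sum.inl (Sum.inr 0) else Sum.inr u)
    obtain ⟨ψ, hψ⟩ := exists_formula_withConstants_exists (M := M) (θ.relabel g)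
    refine ⟨ψ, fun x => ?_⟩
    rw [hψ]
    have hg (w : V → M) : Sum.elim (Sum.elim (fun a : A => (a : M)) x) w ∘ g =
        Sum.elim p (fun u => if u ∈ I then f u else if u = v then x 0 else w u) := by
      funext y
      rcases y with q | u
      · rfl
      · simp only [g, Function.comp, Sum.elim_inr]
        split_ifs <;> rfl
    constructor
    · rintro ⟨w, hw⟩
      rw [FirstOrder.Language.Formula.realize_relabel, hg, hθ] at hw
      exact ⟨_, fun u hu => by simp [hu], by simp [hv], hw⟩
    · rintro ⟨w, hwI, hwv, hw⟩
      refine ⟨w, ?_⟩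
      rw [FirstOrder.Language.Formula.realize_relabel, hg, hθ]
      suffices (fun u => if u ∈ I then f u else if u = v then x 0 else w u) = w by
        rwa [this]
      funext u
      split_ifs with h1 h2
      · exact (hwI h1).symm
      · rw [h2, hwv]
      · rfl
  choose ψ hψ using hQ
  obtain ⟨x, hx⟩ := hsat A hA 1 {χ | ∃ s : Finset (L.Formula (P ⊕ V)), (s : Set _) ⊆ Γ ∧ χ = ψ s} (by
    intro t ht
    choose! S hS using ht
    obtain ⟨w, hwI, hw⟩ := h (t.biUnion S) (by
      intro φ hφ
      obtain ⟨χ, hχ, hφ⟩ := Finset.mem_biUnion.1 (Finset.mem_coe.1 hφ)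
      exact (hS hχ).1 hφ)
    refine ⟨fun _ => w v, fun χ hχ => ?_⟩
    rw [(hS hχ).2, hψ]
    exact ⟨w, hwI, rfl, fun φ hφ => hw φ (Finset.mem_biUnion.2 ⟨χ, hχ, hφ⟩)⟩)
  refine ⟨x 0, fun s hs => ?_⟩
  obtain ⟨w, hwI, hwv, hw⟩ := (hψ s x).1 (hx _ ⟨s, hs, rfl⟩)
  refine ⟨w, ?_, hw⟩
  intro u hu
  rcases hu with rfl | hu
  · simpa using hwv
  · rw [hwI hu, Function.update_of_ne]
    rintro rfl
    exact hv hu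

/-- Well-order `V` in the order type of its cardinal, so that proper initial segments have fewer
than κ elements, and choose the values one at a time by recursion. -/
theorem IsSaturated.exists_realize [Nonempty M] (hκ : ℵ₀ ≤ κ) (hsat : IsSaturated L M κ)
    {P V : Type u} (hP : #P < κ) (hV : #V ≤ κ) (p : P → M) (Γ : Set (L.Formula (P ⊕ V)))
    (h : ∀ s : Finset (L.Formula (P ⊕ V)), (s : Set _) ⊆ Γ →
      ∃ w : V → M, ∀ φ ∈ s, φ.Realize (Sum.elim p w)) :
    ∃ w : V → M, ∀ φ ∈ Γ, φ.Realize (Sum.elim p w) := by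
  classical
  obtain ⟨_, _, hord⟩ := exists_ord_eq_type_lt V
  have hI (v : V) : #(Set.Iio v) < κ := (mk_Iio_lt v hord).trans_le hV
  let F (v : V) (g : ∀ u, u < v → M) : M :=
    let g' : V → M := fun u => if hu : u < v then g u hu else Classical.arbitrary M
    if hm : ∃ m, ExtendsFinitely p Γ (insert v (Set.Iio v)) (Function.update g' v m) then
      hm.choose else Classical.arbitrary M
  let f : V → M := (wellFounded_lt (α := V)).fix F
  have congr {I : Set V} {f g : V → M} (hfg : Set.EqOn f g I) (hf : ExtendsFinitely p Γ I f) :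
      ExtendsFinitely p Γ I g := fun s hs => by
    obtain ⟨w, h1, h2⟩ := hf s hs
    exact ⟨w, h1.trans hfg, h2⟩
  have support (s : Finset (L.Formula (P ⊕ V))) : ∃ t : Finset V, ∀ w w' : V → M,
      (∀ u ∈ t, w u = w' u) → (∀ φ ∈ s, φ.Realize (Sum.elim p w)) →
        ∀ φ ∈ s, φ.Realize (Sum.elim p w') := by
    obtain ⟨θ, hθ⟩ := exists_formula_forall_mem (M := M) s
    obtain ⟨t, ht⟩ := exists_finset_support (M := M) θ
    refine ⟨t.preimage Sum.inr Sum.inr_injective.injOn, fun w w' hww => ?_⟩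
    rw [← hθ, ← hθ, ht]
    · exact id
    · rintro (q | u) hu
      · rfl
      · exact hww u (Finset.mem_preimage.2 hu)
  -- A finite subset of `Γ` mentions finitely many variables, so the largest of them in `I` gives a
  -- stage that suffices; if there is none, `h` applies.
  have limit (I : Set V) (hlim : ∀ v ∈ I, ExtendsFinitely p Γ (Set.Iic v) f) :
      ExtendsFinitely p Γ I f := by
    intro s hs
    obtain ⟨t, ht⟩ := support s
    obtain ⟨w, hw, hws⟩ : ∃ w : V → M, (∀ u ∈ t, u ∈ I → w u = f u) ∧
        ∀ φ ∈ s, φ.Realize (Sum.elim p w) := by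
      rcases (t.filter (· ∈ I)).eq_empty_or_nonempty with h0 | h0
      · obtain ⟨w, hw⟩ := h s hs
        exact ⟨w, fun u hu huI => absurd (Finset.mem_filter.2 ⟨hu, huI⟩) (by simp [h0]), hw⟩
      · obtain ⟨w, hw, hws⟩ := hlim _ (Finset.mem_filter.1 (Finset.max'_mem _ h0)).2 s hs
        exact ⟨w, fun u hu huI => hw (Finset.le_max' _ _ (Finset.mem_filter.2 ⟨hu, huI⟩)), hws⟩
    refine ⟨fun u => if u ∈ I then f u else w u, fun u hu => by simp [hu], ht w _ ?_ hws⟩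
    intro u hu
    by_cases huI : u ∈ I
    · simp [huI, hw u hu huI]
    · simp [huI]
  have main (v : V) : ExtendsFinitely p Γ (Set.Iic v) f := by
    induction v using WellFoundedLT.induction with
    | ind v ih =>
      have hlt := limit (Set.Iio v) fun u hu => ih u hu
      let g' : V → M := fun u => if u < v then f u else Classical.arbitrary M
      have hg' : ExtendsFinitely p Γ (Set.Iio v) g' :=
        congr (fun u hu => by simp only [g', if_pos (Set.mem_Iio.1 hu)]) hlt
      have hm := hg'.exists_update hκ hsat hP (hI v) (v := v) (lt_irrefl v)
      have hfv : f v = hm.choose := by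
        have : f v = F v fun u _ => f u := (wellFounded_lt (α := V)).fix_eq F v
        rw [this]
        exact dif_pos hm
      rw [← Set.Iio_insert]
      refine congr ?_ hm.choose_spec
      intro u hu
      rcases hu with rfl | hu
      · simp [hfv]
      · have hu' : u < v := hu
        rw [Function.update_of_ne hu'.ne]
        simp [g', hu']
  refine ⟨f, fun φ hφ => ?_⟩
  obtain ⟨w, hw, hws⟩ := limit Set.univ (fun v _ => main v) {φ} (by simpa using hφ)
  have : w = f := funext fun u => hw (Set.mem_univ u)
  exact this ▸ hws φ (by simp)

end Saturation

/-! ### Homogeneity for tuples. -/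

section Homogeneity

variable {L : FirstOrder.Language.{u₁, u₂}} {M : Type u} [L.Structure M] {κ : Cardinal.{u}}

theorem IsStronglyHomogeneous.exists_equiv (hhom : IsStronglyHomogeneous L M κ) {ι : Type u}
    (hι : #ι < κ) {b b' : ι → M} (h : ∀ φ : L.Formula ι, φ.Realize b ↔ φ.Realize b') :
    ∃ σ : M ≃[L] M, σ ∘ b = b' := by
  -- The tuple `b` may repeat entries; the formulas `x_i = x_j` force the same repetitions in `b'`.
  have heq {i j : ι} (hij : b i = b j) : b' i = b' j := by
    have := (h ((FirstOrder.Language.Term.var i).equal (FirstOrder.Language.Term.var j))).1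
      (by simpa using hij)
    simpa using this
  choose g hg using fun a : Set.range b => a.2
  obtain ⟨σ, hσ⟩ := hhom (Set.range b) (mk_range_le.trans_lt hι) (fun a => b' (g a)) (fun φ => by
    have := h (φ.relabel g)
    rw [FirstOrder.Language.Formula.realize_relabel,
      FirstOrder.Language.Formula.realize_relabel] at this
    have hb : b ∘ g = fun a : Set.range b => (a : M) := funext hg
    rwa [hb] at this)
  refine ⟨σ, funext fun i => ?_⟩
  exact (hσ ⟨b i, i, rfl⟩).trans (heq (hg _))

end Homogeneity

/-! ### Closure properties of type-definable sets. -/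

section TypeDefinable

variable {L : FirstOrder.Language.{u₁, u₂}} {M : Type u} [L.Structure M] {κ : Cardinal.{u}}
  {α β : Type u}

theorem IsTypeDefinable.comp {D : Set (α → M)} (hD : IsTypeDefinable L D) (f : α → β) :
    IsTypeDefinable L {x : β → M | x ∘ f ∈ D} := by
  obtain ⟨π, hπ⟩ := hD
  refine ⟨FirstOrder.Language.Formula.relabel f '' π, fun x => ?_⟩
  simp [hπ, FirstOrder.Language.Formula.realize_relabel]

theorem IsTypeDefinable.inter {D D' : Set (α → M)} (hD : IsTypeDefinable L D)
    (hD' : IsTypeDefinable L D') : IsTypeDefinable L (D ∩ D') := by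
  obtain ⟨π, hπ⟩ := hD
  obtain ⟨π', hπ'⟩ := hD'
  refine ⟨π ∪ π', fun x => ?_⟩
  simp only [Set.mem_inter_iff, hπ, hπ', Set.mem_union, or_imp, forall_and]

theorem IsTypeDefinable.mem_of_equiv {D : Set (α → M)} (hD : IsTypeDefinable L D)
    (σ : M ≃[L] M) {x : α → M} (hx : x ∈ D) : σ ∘ x ∈ D := by
  obtain ⟨π, hπ⟩ := hD
  rw [hπ] at hx ⊢
  exact fun φ hφ => (FirstOrder.Language.StrongHomClass.realize_formula σ φ).2 (hx φ hφ)

theorem isTypeDefinable_orbit (hhom : IsStronglyHomogeneous L M κ) (hα : #α < κ) (b : α → M) :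
    IsTypeDefinable L {x : α → M | ∃ σ : M ≃[L] M, σ ∘ x = b} := by
  refine ⟨{φ | φ.Realize b}, fun x => ⟨?_, fun h => hhom.exists_equiv hα fun φ => ⟨?_, h φ⟩⟩⟩
  · rintro ⟨σ, rfl⟩ φ hφ
    exact (FirstOrder.Language.StrongHomClass.realize_formula σ φ).1 hφ
  · intro hφ
    by_contra hb
    exact h φ.not hb hφ

/-- In a `κ`-saturated structure, projections of type-definable sets are type-definable. -/
theorem IsTypeDefinable.exists [Nonempty M] (hκ : ℵ₀ ≤ κ) (hsat : IsSaturated L M κ)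
    (hα : #α < κ) (hβ : #β ≤ κ) {D : Set (α ⊕ β → M)} (hD : IsTypeDefinable L D) :
    IsTypeDefinable L {x : α → M | ∃ y : β → M, Sum.elim x y ∈ D} := by
  obtain ⟨π, hπ⟩ := hD
  -- All formulas true on the projection are taken; they include `∃ y, θ` for each finite
  -- conjunction `θ` from `π`, which makes the type of a witness finitely satisfiable.
  refine ⟨{φ | ∀ (x : α → M) (y : β → M), Sum.elim x y ∈ D → φ.Realize x}, fun x => ⟨?_, fun h => ?_⟩⟩
  · rintro ⟨y, hy⟩ φ hφ
    exact hφ x y hy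
  · obtain ⟨y, hy⟩ := hsat.exists_realize hκ hα hβ x π (fun s hs => by
      obtain ⟨θ, hθ⟩ := exists_formula_forall_mem (M := M) s
      obtain ⟨χ, hχ⟩ := exists_formula_exists (M := M) θ
      have := h χ fun x y hxy => (hχ x).2 ⟨y, (hθ _).2 fun φ hφ => (hπ _).1 hxy φ (hs hφ)⟩
      obtain ⟨y, hy⟩ := (hχ x).1 this
      exact ⟨y, (hθ _).1 hy⟩)
    exact ⟨y, (hπ _).2 hy⟩

end TypeDefinable

/-! ### Iterated ultrafilters on increasing tuples. -/

section IteratedUltrafilter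

open Filter

/-- The `n`-fold iterated product of a nonprincipal ultrafilter on `ℕ`. -/
noncomputable def iteratedUltrafilter : (n : ℕ) → Ultrafilter (Fin n → ℕ)
  | 0 => pure Fin.elim0
  | n + 1 => (hyperfilter ℕ).bind fun i => (iteratedUltrafilter n).map (Fin.cons i)

theorem eventually_iteratedUltrafilter_succ {n : ℕ} {p : (Fin (n + 1) → ℕ) → Prop} :
    (∀ᶠ t in iteratedUltrafilter (n + 1), p t) ↔
      ∀ᶠ i in hyperfilter ℕ, ∀ᶠ t in iteratedUltrafilter n, p (Fin.cons i t) :=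
  Iff.rfl

theorem tendsto_comp_iteratedUltrafilter {m n : ℕ} {j : Fin m → Fin n} (hj : StrictMono j) :
    Tendsto (fun t : Fin n → ℕ => t ∘ j) (iteratedUltrafilter n) (iteratedUltrafilter m) := by
  induction n generalizing m with
  | zero =>
    obtain rfl : m = 0 := by
      rcases m with _ | m
      · rfl
      · exact (j 0).elim0
    have : (fun t : Fin 0 → ℕ => t ∘ j) = id := funext fun t => Subsingleton.elim _ _
    rw [this]
    exact tendsto_id
  | succ n ih =>
    intro s hs
    change ∀ᶠ t in iteratedUltrafilter (n + 1), t ∘ j ∈ s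
    rw [eventually_iteratedUltrafilter_succ]
    -- If `j` misses 0, the first coordinate is dropped; otherwise `j 0 = 0` and induction applies
    -- to the remaining coordinates.
    by_cases h : ∃ j' : Fin m → Fin n, j = Fin.succ ∘ j'
    · obtain ⟨j', rfl⟩ := h
      have hj' : StrictMono j' := fun a b hab => Fin.succ_lt_succ_iff.1 (hj hab)
      exact Eventually.of_forall fun i => ih hj' hs
    · rcases m with _ | m
      · exact absurd ⟨Fin.elim0, Subsingleton.elim _ _⟩ h
      have h0 : j 0 = 0 := by
        by_contra h0
        refine h ⟨fun a => (j a).pred fun ha => h0 (Fin.le_zero_iff.1 (ha ▸ hj.monotone (Fin.zero_le a))), ?_⟩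
        funext a
        simp
      have hpos (a : Fin m) : j a.succ ≠ 0 := by
        have := hj (Fin.succ_pos a)
        rw [h0] at this
        exact this.ne'
      have hj' : StrictMono fun a => (j a.succ).pred (hpos a) := fun a b hab =>
        Fin.pred_lt_pred_iff.2 (hj (Fin.succ_lt_succ_iff.2 hab))
      have hs' : ∀ᶠ i in hyperfilter ℕ, ∀ᶠ t in iteratedUltrafilter m, Fin.cons i t ∈ s := hs
      refine hs'.mono fun i hi => ?_
      refine ((ih hj').eventually hi).mono fun t ht => ?_
      suffices (Fin.cons i t : Fin (n + 1) → ℕ) ∘ j =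
          Fin.cons i (t ∘ fun a => (j a.succ).pred (hpos a)) by
        rwa [this]
      funext a
      refine Fin.cases ?_ (fun a => ?_) a
      · simp [h0]
      · simp only [Function.comp, Fin.cons_succ]
        conv_lhs => rw [← Fin.succ_pred _ (hpos a), Fin.cons_succ]

theorem eventually_strictMono_iteratedUltrafilter (n : ℕ) :
    ∀ᶠ t : Fin n → ℕ in iteratedUltrafilter n, StrictMono t := by
  have two : ∀ᶠ t : Fin 2 → ℕ in iteratedUltrafilter 2, t 0 < t 1 := by
    rw [eventually_iteratedUltrafilter_succ]
    refine Eventually.of_forall fun i => ?_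
    rw [eventually_iteratedUltrafilter_succ]
    have : ∀ᶠ j in hyperfilter ℕ, i < j :=
      Nat.hyperfilter_le_atTop (eventually_gt_atTop i)
    exact this.mono fun j hj => Eventually.of_forall fun t => hj
  simp only [StrictMono, eventually_all]
  intro a b hab
  have hj : StrictMono ![a, b] := by
    intro x y hxy
    fin_cases x <;> fin_cases y <;> simp_all
  exact ((tendsto_comp_iteratedUltrafilter hj).eventually two).mono fun t ht => ht

/-- A filter on sequences all of whose restrictions along increasing maps are the iterated products
of a nonprincipal ultrafilter. -/
theorem exists_filter_tendsto_iteratedUltrafilter : ∃ F : Filter (ℕ → ℕ), F.NeBot ∧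
    ∀ (n : ℕ) (j : Fin n → ℕ), StrictMono j →
      Tendsto (fun t => t ∘ j) F (iteratedUltrafilter n) := by
  -- The zero tail is harmless: a fixed `j` reads finitely many coordinates, all below `m` for
  -- almost every `m`.
  let ext (m : ℕ) (t : Fin m → ℕ) : ℕ → ℕ := fun k => if h : k < m then t ⟨k, h⟩ else 0
  refine ⟨((hyperfilter ℕ).bind fun m => (iteratedUltrafilter m).map (ext m) :
    Ultrafilter (ℕ → ℕ)), inferInstance, fun n j hj s hs => ?_⟩
  change ∀ᶠ m in hyperfilter ℕ, ∀ᶠ t in iteratedUltrafilter m, ext m t ∘ j ∈ s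
  have : ∀ᶠ m in hyperfilter ℕ, ∀ a, j a < m :=
    Nat.hyperfilter_le_atTop (eventually_all.2 fun a => eventually_gt_atTop (j a))
  refine this.mono fun m hm => ?_
  have hj' : StrictMono fun a => (⟨j a, hm a⟩ : Fin m) := fun a b hab => hj hab
  refine ((tendsto_comp_iteratedUltrafilter hj').eventually hs).mono fun t ht => ?_
  suffices ext m t ∘ j = t ∘ fun a => (⟨j a, hm a⟩ : Fin m) by
    rwa [this]
  funext a
  simp [ext, hm a]

end IteratedUltrafilter

/-! ### Extraction of indiscernible sequences. -/

section Extraction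

open Filter

variable {L : FirstOrder.Language.{u₁, u₂}} {M : Type u} [L.Structure M] {κ : Cardinal.{u}}
  {δ : Type u}

/-- The types of finite subfamilies of `e` depend only on the order type of the indices. -/
def IsOrderIndiscernible (L : FirstOrder.Language.{u₁, u₂}) {M : Type u} [L.Structure M]
    {δ : Type u} (e : ℕ → δ → M) : Prop :=
  ∀ (ι : Type) [Finite ι] (f g : ι → ℕ), (∀ s t, f s < f t ↔ g s < g t) →
    ∀ φ : L.Formula (ι × δ),
      φ.Realize (fun p => e (f p.1) p.2) ↔ φ.Realize (fun p => e (g p.1) p.2)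

theorem isOrderIndiscernible_of_strictMono {e : ℕ → δ → M}
    (h : ∀ (n : ℕ) (i j : Fin n → ℕ), StrictMono i → StrictMono j → ∀ φ : L.Formula (Fin n × δ),
      φ.Realize (fun p => e (i p.1) p.2) → φ.Realize (fun p => e (j p.1) p.2)) :
    IsOrderIndiscernible L e := by
  classical
  suffices key : ∀ (ι : Type) [Finite ι] (f g : ι → ℕ), (∀ s t, f s < f t ↔ g s < g t) →
      ∀ φ : L.Formula (ι × δ),
        φ.Realize (fun p => e (f p.1) p.2) → φ.Realize (fun p => e (g p.1) p.2) from
    fun ι _ f g hfg φ => ⟨key ι f g hfg φ, key ι g f (fun s t => (hfg s t).symm) φ⟩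
  intro ι _ f g hfg φ hφ
  have := Fintype.ofFinite ι
  -- Enumerate the distinct values of `f` increasingly by `i`; `r` gives ranks and `c` picks
  -- preimages, so that `g ∘ c` is the matching enumeration for `g`.
  let R : Finset ℕ := Finset.univ.image f
  let i : Fin R.card → ℕ := R.orderEmbOfFin rfl
  have hi : StrictMono i := (R.orderEmbOfFin rfl).strictMono
  have hr (s : ι) : ∃ a, i a = f s := by
    have : f s ∈ Set.range i := by
      rw [Finset.range_orderEmbOfFin]
      simp [R]
    exact this
  choose r hr using hr
  have hc (a : Fin R.card) : ∃ s, f s = i a := by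
    have : i a ∈ R := R.orderEmbOfFin_mem rfl a
    simpa [R] using this
  choose c hc using hc
  have hj : StrictMono (g ∘ c) := fun a b hab => (hfg _ _).1 (by rw [hc, hc]; exact hi hab)
  have hgr (s : ι) : g (c (r s)) = g s := by
    have h1 : f (c (r s)) = f s := (hc _).trans (hr s)
    have h2 := hfg (c (r s)) s
    have h3 := hfg s (c (r s))
    rw [h1] at h2 h3
    exact le_antisymm (not_lt.1 fun h => lt_irrefl _ (h3.2 h)) (not_lt.1 fun h => lt_irrefl _ (h2.2 h))
  have := h _ i (g ∘ c) hi hj (φ.relabel (Prod.map r id)) (by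
    rw [FirstOrder.Language.Formula.realize_relabel]
    simpa only [Function.comp_def, Prod.map, id_eq, hr] using hφ)
  rw [FirstOrder.Language.Formula.realize_relabel] at this
  simpa only [Function.comp_def, Prod.map, id_eq, hgr] using this

/-- The ultrafilters replace Ramsey's theorem. A formula or its negation holds on almost all
increasing tuples of `e`, and saturation realizes all these decisions by one sequence. -/
theorem IsSaturated.exists_isOrderIndiscernible [Nonempty M] (hκ : ℵ₀ ≤ κ)
    (hsat : IsSaturated L M κ) (hδ : #δ < κ) (e : ℕ → δ → M) :
    ∃ e' : ℕ → δ → M, IsOrderIndiscernible L e' ∧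
      ∀ D : Set (δ ⊕ δ → M), IsTypeDefinable L D → (∀ i j, i < j → Sum.elim (e i) (e j) ∈ D) →
        ∀ i j, i < j → Sum.elim (e' i) (e' j) ∈ D := by
  obtain ⟨F, _, hF⟩ := exists_filter_tendsto_iteratedUltrafilter
  have hV : #(ℕ × δ) ≤ κ := by
    rw [mk_prod, mk_nat, lift_aleph0, lift_uzero]
    exact mul_le_of_le hκ hκ hδ.le
  obtain ⟨w, hw⟩ := hsat.exists_realize hκ (P := PEmpty.{u + 1}) (V := ℕ × δ)
    (by simpa using aleph0_pos.trans_le hκ) hV PEmpty.elim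
    {φ | ∀ᶠ t in F, φ.Realize (Sum.elim PEmpty.elim fun q => e (t q.1) q.2)} (fun s hs => by
      have : ∀ᶠ t in F, ∀ φ ∈ s, φ.Realize (Sum.elim PEmpty.elim fun q => e (t q.1) q.2) :=
        (Finset.eventually_all s).2 fun φ hφ => hs hφ
      obtain ⟨t, ht⟩ := this.exists
      exact ⟨_, ht⟩)
  have transfer (n : ℕ) (j : Fin n → ℕ) (hj : StrictMono j) (φ : L.Formula (Fin n × δ))
      (h : ∀ᶠ s : Fin n → ℕ in iteratedUltrafilter n, φ.Realize fun p => e (s p.1) p.2) :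
      φ.Realize fun p => w (j p.1, p.2) := by
    have := hw (φ.relabel fun p => Sum.inr (j p.1, p.2)) (by
      refine ((hF n j hj).eventually h).mono fun t ht => ?_
      rw [FirstOrder.Language.Formula.realize_relabel]
      exact ht)
    rw [FirstOrder.Language.Formula.realize_relabel] at this
    exact this
  refine ⟨fun i d => w (i, d), isOrderIndiscernible_of_strictMono ?_, ?_⟩
  · intro n i j hi hj φ hφ
    refine transfer n j hj φ ?_
    by_contra hcon
    have hnot : ∀ᶠ s : Fin n → ℕ in iteratedUltrafilter n, φ.not.Realize fun p => e (s p.1) p.2 :=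
      Ultrafilter.eventually_not.2 hcon
    exact transfer n i hi φ.not hnot hφ
  · rintro D ⟨π, hπ⟩ h i j hij
    rw [hπ]
    intro φ hφ
    have hij' : StrictMono ![i, j] := by
      intro x y hxy
      fin_cases x <;> fin_cases y <;> simp_all
    have := transfer 2 ![i, j] hij' (φ.relabel (Sum.elim (fun d => (0, d)) fun d => (1, d))) (by
      refine (eventually_strictMono_iteratedUltrafilter 2).mono fun t ht => ?_
      rw [FirstOrder.Language.Formula.realize_relabel]
      have := (hπ _).1 (h (t 0) (t 1) (ht (by simp))) φ hφ
      convert this using 1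
      funext x
      rcases x with x | x <;> rfl)
    rw [FirstOrder.Language.Formula.realize_relabel] at this
    convert this using 1
    funext x
    rcases x with x | x <;> rfl

theorem IsSaturated.exists_isOrderIndiscernible_of_finite [Nonempty M] (hκ : ℵ₀ ≤ κ)
    (hsat : IsSaturated L M κ) (hδ : #δ < κ) {D : Set (δ ⊕ δ → M)} (hD : IsTypeDefinable L D)
    (h : ∀ N : ℕ, ∃ e : ℕ → δ → M, ∀ i j, i < j → j < N → Sum.elim (e i) (e j) ∈ D) :
    ∃ e : ℕ → δ → M, IsOrderIndiscernible L e ∧ ∀ i j, i < j → Sum.elim (e i) (e j) ∈ D := by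
  classical
  obtain ⟨π, hπ⟩ := hD
  have hV : #(ℕ × δ) ≤ κ := by
    rw [mk_prod, mk_nat, lift_aleph0, lift_uzero]
    exact mul_le_of_le hκ hκ hδ.le
  let r (i j : ℕ) : δ ⊕ δ → PEmpty.{u + 1} ⊕ (ℕ × δ) :=
    Sum.elim (fun d => Sum.inr (i, d)) fun d => Sum.inr (j, d)
  have hr (i j : ℕ) (w : ℕ × δ → M) : Sum.elim PEmpty.elim w ∘ r i j =
      Sum.elim (fun d => w (i, d)) fun d => w (j, d) := by
    funext x
    rcases x with x | x <;> rfl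
  obtain ⟨w, hw⟩ := hsat.exists_realize hκ (P := PEmpty.{u + 1}) (V := ℕ × δ)
    (by simpa using aleph0_pos.trans_le hκ) hV PEmpty.elim
    {χ | ∃ i j, i < j ∧ ∃ φ ∈ π, χ = φ.relabel (r i j)} (fun s hs => by
      choose! i j hij φ hφ hχ using hs
      -- This length exceeds every index used by the finite set `s`.
      obtain ⟨e, he⟩ := h (s.sup j + 1)
      refine ⟨fun q => e q.1 q.2, fun χ hχs => ?_⟩
      rw [hχ hχs, FirstOrder.Language.Formula.realize_relabel, hr]
      exact (hπ _).1 (he _ _ (hij hχs) (Nat.lt_succ_of_le (Finset.le_sup hχs))) _ (hφ hχs))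
  obtain ⟨e, he, heD⟩ := hsat.exists_isOrderIndiscernible hκ hδ fun i d => w (i, d)
  refine ⟨e, he, heD D ⟨π, hπ⟩ fun i j hij => (hπ _).2 fun φ hφ => ?_⟩
  have := hw _ ⟨i, j, hij, φ, hφ, rfl⟩
  rwa [FirstOrder.Language.Formula.realize_relabel, hr] at this

theorem IsOrderIndiscernible.exists_equiv (hκ : ℵ₀ ≤ κ) (hhom : IsStronglyHomogeneous L M κ)
    (hδ : #δ < κ) {e : ℕ → δ → M} (he : IsOrderIndiscernible L e) {ι : Type} [Finite ι]
    {f g : ι → ℕ} (hfg : ∀ s t, f s < f t ↔ g s < g t) :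
    ∃ σ : M ≃[L] M, ∀ s, σ ∘ e (f s) = e (g s) := by
  have hι : #(ι × δ) < κ := by
    rw [mk_prod]
    refine mul_lt_of_lt hκ ?_ (by simpa using hδ)
    exact (lift_lt_aleph0.2 (lt_aleph0_of_finite ι)).trans_le hκ
  obtain ⟨σ, hσ⟩ := hhom.exists_equiv hι (he ι f g hfg)
  exact ⟨σ, fun s => funext fun d => congrFun hσ (s, d)⟩

end Extraction

/-! ### Types of hyperimaginaries and half-graphs in a stable quotient. -/

section Stability

variable {L : FirstOrder.Language.{u₁, u₂}} {M : Type u} [L.Structure M] {κ : Cardinal.{u}}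
  {α β γ : Type u} {X : Set (α → M)} {Y : Set (β → M)} {E : Setoid X} {F : Setoid Y}

theorem IsHyperdefinable.rel_equiv (hE : IsHyperdefinable L E) (σ : M ≃[L] M) {x y : X}
    (h : E x y) :
    E ⟨σ ∘ x.1, hE.1.mem_of_equiv σ x.2⟩ ⟨σ ∘ y.1, hE.1.mem_of_equiv σ y.2⟩ := by
  obtain ⟨ρ, hρ⟩ := hE.2
  rw [hρ] at h ⊢
  intro φ hφ
  have := (FirstOrder.Language.StrongHomClass.realize_formula σ φ).2 (h φ hφ)
  rwa [Sum.comp_elim] at this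

theorem equiv_symm_comp (σ : M ≃[L] M) {ι : Type*} (x : ι → M) : σ.symm ∘ σ ∘ x = x :=
  funext fun _ => σ.symm_apply_apply _

theorem MapsClass.symm (hE : IsHyperdefinable L E) {σ : M ≃[L] M} {x y : X}
    (h : MapsClass L E σ x y) : MapsClass L E σ.symm y x := by
  obtain ⟨hx, h⟩ := h
  refine ⟨hE.1.mem_of_equiv _ y.2, E.symm' ?_⟩
  have := hE.rel_equiv σ.symm h
  simpa only [equiv_symm_comp] using this

theorem MapsClass.trans (hE : IsHyperdefinable L E) {σ τ : M ≃[L] M} {x y z : X}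
    (h : MapsClass L E σ x y) (h' : MapsClass L E τ y z) : MapsClass L E (τ.comp σ) x z := by
  obtain ⟨hx, h⟩ := h
  obtain ⟨hy, h'⟩ := h'
  exact ⟨hE.1.mem_of_equiv (τ.comp σ) x.2, E.trans' (hE.rel_equiv τ h) h'⟩

theorem MapsClass.of_eq {σ : M ≃[L] M} {x y : X} (h : σ ∘ x.1 = y.1) : MapsClass L E σ x y := by
  refine ⟨h ▸ y.2, ?_⟩
  have : (⟨σ ∘ x.1, h ▸ y.2⟩ : X) = y := Subtype.ext h
  rw [this]

theorem EqType.symm (hE : IsHyperdefinable L E) {ι : Type} {x x' : ι → X} {b b' : ι → γ → M}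
    (h : EqType L E x b x' b') : EqType L E x' b' x b := by
  obtain ⟨σ, hσ⟩ := h
  exact ⟨σ.symm, fun k => ⟨(hσ k).1.symm hE, by rw [← (hσ k).2, equiv_symm_comp]⟩⟩

/-- The set of realizations of `tp (x / E, b)`. -/
def eqTypeSet (L : FirstOrder.Language.{u₁, u₂}) {M : Type u} [L.Structure M] {α γ : Type u}
    {X : Set (α → M)} (E : Setoid X) (x : X) (b : γ → M) : Set (α ⊕ γ → M) :=
  {z | ∃ h : z ∘ Sum.inl ∈ X, ∃ σ : M ≃[L] M, MapsClass L E σ ⟨z ∘ Sum.inl, h⟩ x ∧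
    σ ∘ z ∘ Sum.inr = b}

/-- A pair (z, c) with z in `X` belongs to the set exactly when some y, E-equivalent to z, makes (y,
c) conjugate to (x, b); this is a projection of a type-definable set. -/
theorem isTypeDefinable_eqTypeSet [Nonempty M] (hκ : ℵ₀ ≤ κ) (hsat : IsSaturated L M κ)
    (hhom : IsStronglyHomogeneous L M κ) (hE : IsHyperdefinable L E) (hα : #α < κ) (hγ : #γ < κ)
    (x : X) (b : γ → M) : IsTypeDefinable L (eqTypeSet L E x b) := by
  have hαγ : #(α ⊕ γ) < κ := by
    rw [mk_sum, lift_id, lift_id]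
    exact add_lt_of_lt hκ hα hγ
  obtain ⟨ρ, hρ⟩ := hE.2
  let R : Set (α ⊕ α → M) := {z | ∀ φ ∈ ρ, φ.Realize z}
  have hR : IsTypeDefinable L R := ⟨ρ, fun _ => Iff.rfl⟩
  have h1 := (((isTypeDefinable_orbit hhom hαγ (Sum.elim x.1 b)).comp
    (β := (α ⊕ γ) ⊕ α) (Sum.elim Sum.inr (Sum.inl ∘ Sum.inr))).inter
    (hR.comp (β := (α ⊕ γ) ⊕ α) (Sum.elim (Sum.inl ∘ Sum.inl) Sum.inr))).exists hκ hsat hαγ hα.le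
  have h2 := (hE.1.comp (β := α ⊕ γ) Sum.inl).inter h1
  convert h2 using 1
  ext z
  have e1 (y : α → M) : Sum.elim z y ∘ (Sum.elim Sum.inr (Sum.inl ∘ Sum.inr) : α ⊕ γ → _) =
      Sum.elim y (z ∘ Sum.inr) := by
    funext q
    rcases q with q | q <;> rfl
  have e2 (y : α → M) : Sum.elim z y ∘ (Sum.elim (Sum.inl ∘ Sum.inl) Sum.inr : α ⊕ α → _) =
      Sum.elim (z ∘ Sum.inl) y := by
    funext q
    rcases q with q | q <;> rfl
  simp only [Set.mem_inter_iff, Set.mem_ofPred_eq, e1, e2, R]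
  constructor
  · rintro ⟨hz, σ, hσ, hb⟩
    refine ⟨hz, σ.symm ∘ x.1, ⟨σ, ?_⟩, ?_⟩
    · rw [Sum.comp_elim, hb]
      congr 1
      exact funext fun _ => σ.apply_symm_apply _
    · obtain ⟨h, hE'⟩ := hσ.symm hE
      exact (hρ ⟨_, hz⟩ ⟨_, h⟩).1 (E.symm' hE')
  · rintro ⟨hz, y, ⟨σ, hσ⟩, hy⟩
    have hσx : σ ∘ y = x.1 := funext fun q => congrFun hσ (Sum.inl q)
    have hσb : σ ∘ z ∘ Sum.inr = b := funext fun q => congrFun hσ (Sum.inr q)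
    have hyX : y ∈ X := by
      have := hE.1.mem_of_equiv σ.symm x.2
      rwa [← hσx, equiv_symm_comp] at this
    have hzy : E ⟨_, hz⟩ ⟨y, hyX⟩ := (hρ _ _).2 hy
    refine ⟨hz, σ, ⟨hE.1.mem_of_equiv σ hz, ?_⟩, hσb⟩
    have := hE.rel_equiv σ hzy
    simpa only [hσx] using this

/-- `D ⊆ M ^ (α ⊕ γ)` is a union of `E`-classes in the first coordinate, on `X`. -/
def IsInvariant (E : Setoid X) (D : Set (α ⊕ γ → M)) : Prop :=
  ∀ x x' : X, E x x' → ∀ b : γ → M, Sum.elim x.1 b ∈ D → Sum.elim x'.1 b ∈ D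

theorem isInvariant_eqTypeSet (hE : IsHyperdefinable L E) (x : X) (b : γ → M) :
    IsInvariant E (eqTypeSet L E x b) := by
  rintro y y' h c ⟨hy, σ, ⟨hσ, hyx⟩, hc⟩
  exact ⟨y'.2, σ, ⟨hE.1.mem_of_equiv σ y'.2, E.trans' (E.symm' (hE.rel_equiv σ h)) hyx⟩, hc⟩

/-- In a stable quotient, an invariant type-definable set and a type-definable set that are
separated by arbitrarily long half-graphs meet. -/
theorem IsStable.inter_nonempty [Nonempty M] (hκ : ℵ₀ ≤ κ) (hsat : IsSaturated L M κ)
    (hhom : IsStronglyHomogeneous L M κ) (hE : IsHyperdefinable L E) (hst : IsStable L κ E)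
    (hα : #α < κ) (hγ : #γ < κ) {D D' : Set (α ⊕ γ → M)} (hD : IsTypeDefinable L D)
    (hD' : IsTypeDefinable L D') (hinv : IsInvariant E D)
    (h : ∀ N : ℕ, ∃ (x : ℕ → X) (b : ℕ → γ → M), ∀ i j, i < j → j < N →
      Sum.elim (x i).1 (b j) ∈ D ∧ Sum.elim (x j).1 (b i) ∈ D') :
    (D ∩ D').Nonempty := by
  have hαγ : #(α ⊕ γ) < κ := by
    rw [mk_sum, lift_id, lift_id]
    exact add_lt_of_lt hκ hα hγ
  have e1 (x x' : α → M) (b b' : γ → M) : Sum.elim (Sum.elim x b) (Sum.elim x' b') ∘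
      (Sum.elim (Sum.inl ∘ Sum.inl) (Sum.inr ∘ Sum.inr) : α ⊕ γ → _) = Sum.elim x b' := by
    funext q
    rcases q with q | q <;> rfl
  have e2 (x x' : α → M) (b b' : γ → M) : Sum.elim (Sum.elim x b) (Sum.elim x' b') ∘
      (Sum.elim (Sum.inr ∘ Sum.inl) (Sum.inl ∘ Sum.inr) : α ⊕ γ → _) = Sum.elim x' b := by
    funext q
    rcases q with q | q <;> rfl
  obtain ⟨e, he, heD⟩ := hsat.exists_isOrderIndiscernible_of_finite hκ hαγ
    ((hE.1.comp (β := (α ⊕ γ) ⊕ (α ⊕ γ)) (Sum.inl ∘ Sum.inl)).inter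
      ((hD.comp (β := (α ⊕ γ) ⊕ (α ⊕ γ)) (Sum.elim (Sum.inl ∘ Sum.inl) (Sum.inr ∘ Sum.inr))).inter
      (hD'.comp (β := (α ⊕ γ) ⊕ (α ⊕ γ)) (Sum.elim (Sum.inr ∘ Sum.inl) (Sum.inl ∘ Sum.inr)))))
    (fun N => by
      obtain ⟨x, b, hxb⟩ := h N
      refine ⟨fun i => Sum.elim (x i).1 (b i), fun i j hij hj => ⟨(x i).2, ?_, ?_⟩⟩
      · simpa only [Set.mem_ofPred_eq, e1] using (hxb i j hij hj).1
      · simpa only [Set.mem_ofPred_eq, e2] using (hxb i j hij hj).2)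
  let x (i : ℕ) : X := ⟨e i ∘ Sum.inl, (heD i (i + 1) (Nat.lt_succ_self i)).1⟩
  let b (i : ℕ) : γ → M := e i ∘ Sum.inr
  have hxb : IsIndiscernible L E x b := by
    intro n i j hi hj
    obtain ⟨σ, hσ⟩ := he.exists_equiv hκ hhom hαγ (f := i) (g := j)
      fun s t => hi.lt_iff_lt.trans hj.lt_iff_lt.symm
    refine ⟨σ, fun k => ⟨MapsClass.of_eq ?_, ?_⟩⟩
    · exact congrArg (· ∘ Sum.inl) (hσ k)
    · exact congrArg (· ∘ Sum.inr) (hσ k)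
  obtain ⟨σ, hσ⟩ := hst γ hγ x b hxb 0 1 zero_ne_one
  obtain ⟨⟨hσX, hσE⟩, hσb⟩ := hσ ()
  have h01 := heD 0 1 zero_lt_one
  have h1 : Sum.elim (x 0).1 (b 1) ∈ D := by
    have := h01.2.1
    rwa [Set.mem_ofPred_eq, Sum.comp_elim] at this
  have h2 : Sum.elim (x 1).1 (b 0) ∈ D' := by
    have := h01.2.2
    rwa [Set.mem_ofPred_eq, Sum.comp_elim] at this
  -- `σ` carries `x 0` only into the class of `x 1`; invariance of `D` absorbs the difference.
  have h3 := hD.mem_of_equiv σ h1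
  rw [Sum.comp_elim, hσb] at h3
  exact ⟨_, hinv _ _ hσE _ h3, h2⟩

end Stability

/-! ### Products of stable quotients. -/

section Product

variable {L : FirstOrder.Language.{u₁, u₂}} {M : Type u} [L.Structure M] {κ : Cardinal.{u}}
  {α β γ δ : Type u} {X : Set (α → M)} {Y : Set (β → M)} {E : Setoid X} {F : Setoid Y}

/-- The indices of the `k`-th block: first a base point, then `N` indices, of which the first `n` do
not depend on `k` and precede all base points, whereas the others follow the `k`-th base point and
precede the next one. -/
def blockIndex (N n k : ℕ) : Option (Fin N) → ℕ
  | none => n + k * (N + 1)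
  | some t => if (t : ℕ) < n then t else k * (N + 1) + 1 + t

theorem blockIndex_lt_iff {N n : ℕ} (hn : n ≤ N) {m : ℕ} {i j : Fin m → ℕ} (hi : StrictMono i)
    (hj : StrictMono j) (s t : Fin m × Option (Fin N)) :
    blockIndex N n (i s.1) s.2 < blockIndex N n (i t.1) t.2 ↔
      blockIndex N n (j s.1) s.2 < blockIndex N n (j t.1) t.2 := by
  have step {k l : ℕ} (h : k < l) : k * (N + 1) + (N + 1) ≤ l * (N + 1) := by
    have := Nat.mul_le_mul_right (N + 1) (Nat.succ_le_of_lt h)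
    rwa [Nat.succ_mul] at this
  obtain ⟨k, s⟩ := s
  obtain ⟨l, t⟩ := t
  rcases lt_trichotomy k l with h | rfl | h
  on_goal 1 => have h1 := step (hi h)
  on_goal 1 => have h2 := step (hj h)
  on_goal 3 => have h1 := step (hi h)
  on_goal 3 => have h2 := step (hj h)
  all_goals
    rcases s with _ | s <;> rcases t with _ | t <;> simp only [blockIndex]
    all_goals
      generalize i k * (N + 1) = p at *
      generalize j k * (N + 1) = p' at *
      try generalize i l * (N + 1) = q at *
      try generalize j l * (N + 1) = q' at *
      (try split_ifs) <;> omega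

/-- Over an indiscernible sequence, the type of the class of a term over `N` other terms does not
depend on the position of that term. -/
theorem IsStable.exists_equiv_skip (hκ : ℵ₀ ≤ κ) (hhom : IsStronglyHomogeneous L M κ)
    (hE : IsHyperdefinable L E) (hst : IsStable L κ E) (hδ : #δ < κ) {e : ℕ → δ → M}
    (he : IsOrderIndiscernible L e) {p : α → δ} (hp : ∀ k, e k ∘ p ∈ X) {N n : ℕ} (hn : n ≤ N) :
    ∃ σ : M ≃[L] M, MapsClass L E σ ⟨e n ∘ p, hp n⟩ ⟨e N ∘ p, hp N⟩ ∧
      ∀ t < N, σ ∘ e (if t < n then t else t + 1) = e t := by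
  have hγ : #(Fin N × δ) < κ := by
    rw [mk_prod]
    refine mul_lt_of_lt hκ ?_ (by simpa using hδ)
    exact (lift_lt_aleph0.2 (lt_aleph0_of_finite _)).trans_le hκ
  -- Relative to the terms of `B 1`, `A 0` has exactly `n` predecessors; relative to `B 0`, `A 1`
  -- comes after all `N`. Stability exchanges these two positions.
  let A (k : ℕ) : X := ⟨e (blockIndex N n k none) ∘ p, hp _⟩
  let B (k : ℕ) : Fin N × δ → M := fun q => e (blockIndex N n k (some q.1)) q.2
  have hAB : IsIndiscernible L E A B := by
    intro m i j hi hj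
    obtain ⟨σ, hσ⟩ := he.exists_equiv hκ hhom hδ (blockIndex_lt_iff hn hi hj)
    refine ⟨σ, fun k => ⟨MapsClass.of_eq ?_, ?_⟩⟩
    · exact congrArg (· ∘ p) (hσ (k, none))
    · exact funext fun q => congrFun (hσ (k, some q.1)) q.2
  obtain ⟨τ, hτ⟩ := hst _ hγ A B hAB 0 1 zero_ne_one
  obtain ⟨hτA, hτB⟩ := hτ ()
  obtain ⟨σ₁, hσ₁⟩ := he.exists_equiv hκ hhom hδ (ι := Option (Fin N))
    (f := fun s => s.elim n fun t => if (t : ℕ) < n then t else t + 1)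
    (g := fun s => s.elim (blockIndex N n 0 none) fun t => blockIndex N n 1 (some t)) (by
      rintro (_ | s) (_ | t) <;> simp only [blockIndex, Option.elim] <;> grind)
  obtain ⟨σ₂, hσ₂⟩ := he.exists_equiv hκ hhom hδ (ι := Option (Fin N))
    (f := fun s => s.elim (blockIndex N n 1 none) fun t => blockIndex N n 0 (some t))
    (g := fun s => s.elim N fun t => t) (by
      rintro (_ | s) (_ | t) <;> simp only [blockIndex, Option.elim] <;> grind)
  refine ⟨σ₂.comp (τ.comp σ₁), ?_, fun t ht => ?_⟩
  · have h1 : MapsClass L E σ₁ ⟨e n ∘ p, hp n⟩ (A 0) :=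
      MapsClass.of_eq (congrArg (· ∘ p) (hσ₁ none))
    have h2 : MapsClass L E σ₂ (A 1) ⟨e N ∘ p, hp N⟩ :=
      MapsClass.of_eq (congrArg (· ∘ p) (hσ₂ none))
    exact (h1.trans hE hτA).trans hE h2
  · funext d
    have h1 := congrFun (hσ₁ (some ⟨t, ht⟩)) d
    have h2 := congrFun (hσ₂ (some ⟨t, ht⟩)) d
    have h3 := congrFun hτB (⟨t, ht⟩, d)
    simp only [Function.comp, Option.elim, B] at h1 h2 h3
    simp only [Function.comp, FirstOrder.Language.Equiv.comp_apply]
    rw [h1, h3, h2]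

theorem prodRel_iff {z w : prodSet X Y} : prodRel E F z w ↔
    E ⟨z.1 ∘ Sum.inl, z.2.1⟩ ⟨w.1 ∘ Sum.inl, w.2.1⟩ ∧
      F ⟨z.1 ∘ Sum.inr, z.2.2⟩ ⟨w.1 ∘ Sum.inr, w.2.2⟩ :=
  Iff.rfl

theorem IsHyperdefinable.prodRel (hE : IsHyperdefinable L E) (hF : IsHyperdefinable L F) :
    IsHyperdefinable L (prodRel E F) := by
  refine ⟨(hE.1.comp Sum.inl).inter (hF.1.comp Sum.inr), ?_⟩
  obtain ⟨ρ, hρ⟩ := hE.2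
  obtain ⟨ρ', hρ'⟩ := hF.2
  refine ⟨FirstOrder.Language.Formula.relabel (Sum.map Sum.inl Sum.inl) '' ρ ∪
    FirstOrder.Language.Formula.relabel (Sum.map Sum.inr Sum.inr) '' ρ', fun z w => ?_⟩
  rw [prodRel_iff, hρ, hρ']
  simp only [Set.mem_union, or_imp, forall_and, Set.forall_mem_image,
    FirstOrder.Language.Formula.realize_relabel, Sum.elim_comp_map]

theorem IsStable.prodRel_inter_nonempty [Nonempty M] (hκ : ℵ₀ ≤ κ) (hsat : IsSaturated L M κ)
    (hhom : IsStronglyHomogeneous L M κ) (hE : IsHyperdefinable L E) (hF : IsHyperdefinable L F)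
    (hsE : IsStable L κ E) (hsF : IsStable L κ F) (hα : #α < κ) (hβ : #β < κ) (hγ : #γ < κ)
    {D D' : Set ((α ⊕ β) ⊕ γ → M)} (hD : IsTypeDefinable L D) (hD' : IsTypeDefinable L D')
    (hinv : IsInvariant (prodRel E F) D) (hinv' : IsInvariant (prodRel E F) D')
    (z : ℕ → prodSet X Y) (b : ℕ → γ → M) (h : ∀ i j, i < j →
      Sum.elim (z i).1 (b j) ∈ D ∧ Sum.elim (z j).1 (b i) ∈ D') :
    (D ∩ D').Nonempty := by
  have hEF := hE.prodRel hF
  have card_sum {α β : Type u} (hα : #α < κ) (hβ : #β < κ) : #(α ⊕ β) < κ := by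
    rw [mk_sum, lift_id, lift_id]
    exact add_lt_of_lt hκ hα hβ
  have hδ : #((α ⊕ β) ⊕ γ) < κ := card_sum (card_sum hα hβ) hγ
  obtain ⟨e, he, heD⟩ := hsat.exists_isOrderIndiscernible hκ hδ fun i => Sum.elim (z i).1 (b i)
  have hZ (k : ℕ) : e k ∘ Sum.inl ∈ prodSet X Y :=
    heD _ (hEF.1.comp (β := ((α ⊕ β) ⊕ γ) ⊕ ((α ⊕ β) ⊕ γ)) (Sum.inl ∘ Sum.inl))
      (fun i j _ => (z i).2) k (k + 1) (Nat.lt_succ_self k)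
  have h1 (i j : ℕ) (hij : i < j) : Sum.elim (e i ∘ Sum.inl) (e j ∘ Sum.inr) ∈ D := by
    have := heD _ (hD.comp (β := ((α ⊕ β) ⊕ γ) ⊕ ((α ⊕ β) ⊕ γ))
      (Sum.elim (Sum.inl ∘ Sum.inl) (Sum.inr ∘ Sum.inr)))
      (fun i j hij => by rw [Set.mem_ofPred_eq, Sum.comp_elim]; exact (h i j hij).1) i j hij
    rwa [Set.mem_ofPred_eq, Sum.comp_elim] at this
  have h2 (i j : ℕ) (hij : i < j) : Sum.elim (e j ∘ Sum.inl) (e i ∘ Sum.inr) ∈ D' := by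
    have := heD _ (hD'.comp (β := ((α ⊕ β) ⊕ γ) ⊕ ((α ⊕ β) ⊕ γ))
      (Sum.elim (Sum.inr ∘ Sum.inl) (Sum.inl ∘ Sum.inr)))
      (fun i j hij => by rw [Set.mem_ofPred_eq, Sum.comp_elim]; exact (h i j hij).2) i j hij
    rwa [Set.mem_ofPred_eq, Sum.comp_elim] at this
  let r : (α ⊕ β) ⊕ γ → β ⊕ (γ ⊕ α) :=
    Sum.elim (Sum.elim (Sum.inr ∘ Sum.inr) Sum.inl) (Sum.inr ∘ Sum.inl)
  have hr (y : β → M) (c : γ → M) (x : α → M) :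
      Sum.elim y (Sum.elim c x) ∘ r = Sum.elim (Sum.elim x y) c := by
    simp only [r, Sum.comp_elim]
    rfl
  -- The condition on `X` is added because invariance of `D` is known only on `prodSet X Y`.
  have hinvr : IsInvariant F {w : β ⊕ (γ ⊕ α) → M | w ∘ r ∈ D ∧ w ∘ Sum.inr ∘ Sum.inr ∈ X} := by
    rintro y y' hy c ⟨hc, hcX⟩
    refine ⟨?_, hcX⟩
    obtain ⟨c, x, rfl⟩ : ∃ (c' : γ → M) (x : α → M), c = Sum.elim c' x :=
      ⟨c ∘ Sum.inl, c ∘ Sum.inr, (Sum.elim_comp_inl_inr c).symm⟩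
    rw [hr] at hc ⊢
    exact hinv ⟨Sum.elim x y.1, hcX, y.2⟩ ⟨Sum.elim x y'.1, hcX, y'.2⟩
      (prodRel_iff.2 ⟨E.refl' _, hy⟩) c hc
  have key (N n : ℕ) : ∃ y : Y, n < N → ∀ t < N,
      (n < t → Sum.elim (Sum.elim (e N ∘ Sum.inl ∘ Sum.inl) y.1) (e t ∘ Sum.inr) ∈ D) ∧
      (t < n → Sum.elim (Sum.elim (e N ∘ Sum.inl ∘ Sum.inl) y.1) (e t ∘ Sum.inr) ∈ D') := by
    by_cases hn : n < N
    swap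
    · exact ⟨⟨_, (hZ 0).2⟩, fun h => absurd h hn⟩
    obtain ⟨σ, ⟨hσX, hσE⟩, hσ⟩ := hsE.exists_equiv_skip hκ hhom hE hδ he
      (p := Sum.inl ∘ Sum.inl) (fun k => (hZ k).1) hn.le
    have hσZ := hEF.1.mem_of_equiv σ (hZ n)
    have hrel : prodRel E F ⟨_, hσZ⟩
        ⟨Sum.elim (e N ∘ Sum.inl ∘ Sum.inl) (σ ∘ e n ∘ Sum.inl ∘ Sum.inr), (hZ N).1, hσZ.2⟩ :=
      prodRel_iff.2 ⟨hσE, F.refl' _⟩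
    refine ⟨⟨σ ∘ e n ∘ Sum.inl ∘ Sum.inr, hσZ.2⟩, fun _ t ht => ⟨fun hnt => ?_, fun htn => ?_⟩⟩
    -- The index `n` is skipped, so `σ` sends the term `t + 1` to the term `t`.
    · have := hD.mem_of_equiv σ (h1 n (t + 1) (by omega))
      have hb := hσ t ht
      rw [if_neg (by omega)] at hb
      rw [Sum.comp_elim, ← Function.comp_assoc σ (e (t + 1)), hb] at this
      exact hinv _ _ hrel _ this
    · have := hD'.mem_of_equiv σ (h2 t n htn)
      have hb := hσ t ht
      rw [if_pos htn] at hb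
      rw [Sum.comp_elim, ← Function.comp_assoc σ (e t), hb] at this
      exact hinv' _ _ hrel _ this
  obtain ⟨w, hw, hw'⟩ := hsF.inter_nonempty hκ hsat hhom hF hβ (card_sum hγ hα)
    (D := {w : β ⊕ (γ ⊕ α) → M | w ∘ r ∈ D ∧ w ∘ Sum.inr ∘ Sum.inr ∈ X})
    ((hD.comp r).inter (hE.1.comp (Sum.inr ∘ Sum.inr))) (hD'.comp r) hinvr (fun N => by
      choose y hy using key N
      refine ⟨y, fun t => Sum.elim (e t ∘ Sum.inr) (e N ∘ Sum.inl ∘ Sum.inl),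
        fun i j hij hj => ⟨⟨?_, (hZ N).1⟩, ?_⟩⟩
      · rw [hr]
        exact (hy i (hij.trans hj) j hj).1 hij
      · rw [Set.mem_ofPred_eq, hr]
        exact (hy j hj i (hij.trans hj)).2 hij)
  exact ⟨_, hw.1, hw'⟩

theorem IsStable.prodRel [Nonempty M] (hκ : ℵ₀ ≤ κ) (hsat : IsSaturated L M κ)
    (hhom : IsStronglyHomogeneous L M κ) (hE : IsHyperdefinable L E) (hF : IsHyperdefinable L F)
    (hsE : IsStable L κ E) (hsF : IsStable L κ F) (hα : #α < κ) (hβ : #β < κ) :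
    IsStable L κ (prodRel E F) := by
  have hEF := hE.prodRel hF
  have hαβ : #(α ⊕ β) < κ := by
    rw [mk_sum, lift_id, lift_id]
    exact add_lt_of_lt hκ hα hβ
  intro γ hγ a b hab
  have key (i₀ j₀ : ℕ) (hij₀ : i₀ < j₀) : EqType L (Hyperdef.prodRel E F)
      (fun _ : Unit => a i₀) (fun _ => b j₀) (fun _ : Unit => a j₀) (fun _ => b i₀) := by
    have hmono {i j : ℕ} (hij : i < j) : StrictMono ![i, j] := by
      intro x y hxy
      fin_cases x <;> fin_cases y <;> simp_all
    obtain ⟨w, ⟨hw, σ, hσ, hσb⟩, ⟨_, τ, hτ, hτb⟩⟩ := IsStable.prodRel_inter_nonempty hκ hsat hhom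
      hE hF hsE hsF hα hβ hγ
      (isTypeDefinable_eqTypeSet hκ hsat hhom hEF hαβ hγ (a i₀) (b j₀))
      (isTypeDefinable_eqTypeSet hκ hsat hhom hEF hαβ hγ (a j₀) (b i₀))
      (isInvariant_eqTypeSet hEF _ _) (isInvariant_eqTypeSet hEF _ _) a b (fun i j hij => by
        obtain ⟨σ, hσ⟩ := hab 2 ![i, j] ![i₀, j₀] (hmono hij) (hmono hij₀)
        exact ⟨⟨(a i).2, σ, (hσ 0).1, (hσ 1).2⟩, ⟨(a j).2, σ, (hσ 1).1, (hσ 0).2⟩⟩)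
    -- Both pairs are conjugate to the common realization `w`, hence to each other.
    refine ⟨τ.comp σ.symm, fun _ => ⟨(hσ.symm hEF).trans hEF hτ, ?_⟩⟩
    rw [← hσb, ← hτb]
    exact congrArg (τ ∘ ·) (equiv_symm_comp σ _)
  intro i j hij
  rcases hij.lt_or_gt with h | h
  · exact key i j h
  · exact (key j i h).symm hEF

end Product

/-! ### Intersections of relations with stable quotient. -/

section Infimum

variable {L : FirstOrder.Language.{u₁, u₂}} {M : Type u} [L.Structure M] {κ : Cardinal.{u}}
  {α : Type u} {X : Set (α → M)} {E F : Setoid X}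

theorem isTypeDefinableRel_sInf {S : Set (Setoid X)}
    (hS : ∀ E ∈ S, IsTypeDefinableRel L E) : IsTypeDefinableRel L (sInf S) := by
  choose! ρ hρ using hS
  refine ⟨⋃ E ∈ S, ρ E, fun x y => ?_⟩
  simp only [Set.mem_iUnion, exists_prop, forall_exists_index, and_imp]
  constructor
  · intro h φ E hE hφ
    exact (hρ E hE x y).1 (h E hE) φ hφ
  · intro h E hE
    exact (hρ E hE x y).2 fun φ hφ => h φ E hE hφ

theorem isStable_top (hX : IsTypeDefinable L X) : IsStable L κ (⊤ : Setoid X) := by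
  intro γ _ a b hab i j _
  obtain ⟨σ, hσ⟩ := hab 1 ![j] ![i] (Subsingleton.strictMono _) (Subsingleton.strictMono _)
  exact ⟨σ, fun _ => ⟨⟨hX.mem_of_equiv σ (a i).2, trivial⟩, (hσ 0).2⟩⟩

theorem MapsClass.mono {σ : M ≃[L] M} {x y : X} (hEF : E ≤ F) (h : MapsClass L E σ x y) :
    MapsClass L F σ x y :=
  ⟨h.1, hEF h.2⟩

theorem IsIndiscernible.mono {γ : Type u} {a : ℕ → X} {b : ℕ → γ → M} (hEF : E ≤ F)
    (h : IsIndiscernible L E a b) : IsIndiscernible L F a b := fun n i j hi hj => by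
  obtain ⟨σ, hσ⟩ := h n i j hi hj
  exact ⟨σ, fun k => ⟨(hσ k).1.mono hEF, (hσ k).2⟩⟩

theorem IsStable.inf [Nonempty M] (hκ : ℵ₀ ≤ κ) (hsat : IsSaturated L M κ)
    (hhom : IsStronglyHomogeneous L M κ) (hE : IsHyperdefinable L E) (hF : IsHyperdefinable L F)
    (hsE : IsStable L κ E) (hsF : IsStable L κ F) (hα : #α < κ) : IsStable L κ (E ⊓ F) := by
  intro γ hγ a b hab i j hij
  let d (k : ℕ) : prodSet X X := ⟨Sum.elim (a k).1 (a k).1, (a k).2, (a k).2⟩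
  obtain ⟨σ, hσ⟩ := IsStable.prodRel hκ hsat hhom hE hF hsE hsF hα hα γ hγ d b (by
    intro n i j hi hj
    obtain ⟨σ, hσ⟩ := hab n i j hi hj
    refine ⟨σ, fun k => ⟨?_, (hσ k).2⟩⟩
    obtain ⟨hX, hEF⟩ := (hσ k).1
    exact ⟨⟨hX, hX⟩, prodRel_iff.2 hEF⟩) i j hij
  obtain ⟨⟨hX, hEF⟩, hb⟩ := hσ ()
  exact ⟨σ, fun _ => ⟨⟨hX.1, prodRel_iff.1 hEF⟩, hb⟩⟩

theorem isStable_sInf_finset [Nonempty M] (hκ : ℵ₀ ≤ κ) (hsat : IsSaturated L M κ)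
    (hhom : IsStronglyHomogeneous L M κ) (hX : IsTypeDefinable L X) (hα : #α < κ)
    (S : Finset (Setoid X)) (hS : ∀ E ∈ S, IsTypeDefinableRel L E ∧ IsStable L κ E) :
    IsStable L κ (sInf (S : Set (Setoid X))) := by
  classical
  induction S using Finset.induction_on with
  | empty =>
    have : sInf ((∅ : Finset (Setoid X)) : Set (Setoid X)) = ⊤ :=
      eq_top_iff.2 fun {x y} _ E hE => absurd hE (Finset.notMem_empty E)
    rw [this]
    exact isStable_top hX
  | insert E S _ ih =>
    rw [Finset.coe_insert, sInf_insert]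
    have hS' : ∀ E ∈ S, IsTypeDefinableRel L E ∧ IsStable L κ E := fun E hE =>
      hS E (Finset.mem_insert_of_mem hE)
    have hE := hS E (Finset.mem_insert_self _ _)
    exact IsStable.inf hκ hsat hhom ⟨hX, hE.1⟩
      ⟨hX, isTypeDefinableRel_sInf fun E hE => (hS' E hE).1⟩ hE.2 (ih hS') hα

/-- It suffices to find y with (y, b_i) conjugate to (a_i, b_j) and y equivalent to a_j under every
relation in `S`. These conditions form a type over (a_j, b_i), and each finite part involves
finitely many relations. -/
theorem isStable_sInf [Nonempty M] (hκ : ℵ₀ ≤ κ) (hsat : IsSaturated L M κ)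
    (hhom : IsStronglyHomogeneous L M κ) (hX : IsTypeDefinable L X) (hα : #α < κ)
    (S : Set (Setoid X)) (hS : ∀ E ∈ S, IsTypeDefinableRel L E ∧ IsStable L κ E) :
    IsStable L κ (sInf S) := by
  classical
  intro γ hγ a b hab i j hij
  have hαγ : #(α ⊕ γ) < κ := by
    rw [mk_sum, lift_id, lift_id]
    exact add_lt_of_lt hκ hα hγ
  choose! ρ hρ using fun E hE => (hS E hE).1
  let r₁ : α ⊕ γ → (α ⊕ γ) ⊕ α := Sum.elim Sum.inr (Sum.inl ∘ Sum.inr)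
  let r₂ : α ⊕ α → (α ⊕ γ) ⊕ α := Sum.elim Sum.inr (Sum.inl ∘ Sum.inl)
  have hr₁ (y : α → M) : Sum.elim (Sum.elim (a j).1 (b i)) y ∘ r₁ = Sum.elim y (b i) := by
    simp only [r₁, Sum.comp_elim]
    rfl
  have hr₂ (y : α → M) : Sum.elim (Sum.elim (a j).1 (b i)) y ∘ r₂ = Sum.elim y (a j).1 := by
    simp only [r₂, Sum.comp_elim]
    rfl
  obtain ⟨y, hy⟩ := hsat.exists_realize hκ hαγ hα.le (Sum.elim (a j).1 (b i))
    ({χ | ∃ φ : L.Formula (α ⊕ γ), φ.Realize (Sum.elim (a i).1 (b j)) ∧ χ = φ.relabel r₁} ∪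
      {χ | ∃ E ∈ S, ∃ φ ∈ ρ E, χ = φ.relabel r₂}) (fun s hs => by
      have hE (χ : L.Formula ((α ⊕ γ) ⊕ α)) : ∃ T : Finset (Setoid X), (∀ E ∈ T, E ∈ S) ∧
          (χ ∈ s → (∃ E ∈ S, ∃ φ ∈ ρ E, χ = φ.relabel r₂) →
            ∃ E ∈ T, ∃ φ ∈ ρ E, χ = φ.relabel r₂) := by
        by_cases h : ∃ E ∈ S, ∃ φ ∈ ρ E, χ = φ.relabel r₂
        · obtain ⟨E, hE, h⟩ := h
          exact ⟨{E}, by simpa using hE, fun _ _ => ⟨E, by simp, h⟩⟩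
        · exact ⟨∅, by simp, fun _ h' => absurd h' h⟩
      choose T hTS hT using hE
      let K : Finset (Setoid X) := s.biUnion T
      have hKS : ∀ E ∈ K, E ∈ S := fun E hE => by
        obtain ⟨χ, _, hχ⟩ := Finset.mem_biUnion.1 hE
        exact hTS χ E hχ
      -- The sequence stays indiscernible modulo the coarser relation `sInf K`, and `σ ∘ a i` solves
      -- the finite part.
      obtain ⟨σ, hσ⟩ := isStable_sInf_finset hκ hsat hhom hX hα K (fun E hE => hS E (hKS E hE))
        γ hγ a b (hab.mono (sInf_le_sInf hKS)) i j hij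
      obtain ⟨⟨hσX, hσE⟩, hσb⟩ := hσ ()
      simp only at hσb
      refine ⟨σ ∘ (a i).1, fun χ hχ => ?_⟩
      rcases hs hχ with ⟨φ, hφ, rfl⟩ | h
      · rw [FirstOrder.Language.Formula.realize_relabel, hr₁, ← hσb, ← Sum.comp_elim]
        exact (FirstOrder.Language.StrongHomClass.realize_formula σ φ).2 hφ
      · obtain ⟨E, hE, φ, hφ, rfl⟩ := hT χ hχ h
        have hEK : E ∈ K := Finset.mem_biUnion.2 ⟨_, hχ, hE⟩
        rw [FirstOrder.Language.Formula.realize_relabel, hr₂]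
        exact (hρ E (hKS E hEK) ⟨_, hσX⟩ (a j)).1 (hσE E hEK) φ hφ)
  obtain ⟨σ, hσ⟩ := hhom.exists_equiv hαγ (b := Sum.elim (a i).1 (b j)) (b' := Sum.elim y (b i))
    (fun φ => by
      have key (φ : L.Formula (α ⊕ γ)) (hφ : φ.Realize (Sum.elim (a i).1 (b j))) :
          φ.Realize (Sum.elim y (b i)) := by
        have := hy _ (Or.inl ⟨φ, hφ, rfl⟩)
        rwa [FirstOrder.Language.Formula.realize_relabel, hr₁] at this
      exact ⟨key φ, fun h => by_contra fun hn => key φ.not hn h⟩)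
  have hσa : σ ∘ (a i).1 = y := funext fun q => congrFun hσ (Sum.inl q)
  have hσb : σ ∘ b j = b i := funext fun q => congrFun hσ (Sum.inr q)
  have hyX : y ∈ X := hσa ▸ hX.mem_of_equiv σ (a i).2
  have hyE : (sInf S : Setoid X) ⟨y, hyX⟩ (a j) := fun E hE => (hρ E hE _ _).2 fun φ hφ => by
    have := hy _ (Or.inr ⟨E, hE, φ, hφ, rfl⟩)
    rwa [FirstOrder.Language.Formula.realize_relabel, hr₂] at this
  refine ⟨σ, fun _ => ⟨⟨hX.mem_of_equiv σ (a i).2, ?_⟩, hσb⟩⟩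
  simpa only [hσa] using hyE

end Infimum

end Hyperdef

theorem mainTheorem11 {L : FirstOrder.Language.{u₁, u₂}} {M : Type u} [L.Structure M] [Nonempty M]
    (κ : Cardinal.{u}) (hκ : ℵ₀ ≤ κ)
    (hsat : Hyperdef.IsSaturated L M κ) (hhom : Hyperdef.IsStronglyHomogeneous L M κ) :
    (∀ (α β : Type u), #α < κ → #β < κ →
      ∀ (X : Set (α → M)) (Y : Set (β → M)) (E : Setoid X) (F : Setoid Y),
        Hyperdef.IsHyperdefinable L E → Hyperdef.IsHyperdefinable L F →
        Hyperdef.IsStable L κ E → Hyperdef.IsStable L κ F →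
        Hyperdef.IsHyperdefinable L (Hyperdef.prodRel E F) ∧
          Hyperdef.IsStable L κ (Hyperdef.prodRel E F)) ∧
    (∀ (α : Type u), #α < κ → ∀ X : Set (α → M), Hyperdef.IsTypeDefinable L X →
      (∀ S : Set (Setoid X),
        (∀ E ∈ S, Hyperdef.IsTypeDefinableRel L E ∧ Hyperdef.IsStable L κ E) →
        Hyperdef.IsTypeDefinableRel L (sInf S) ∧ Hyperdef.IsStable L κ (sInf S)) ∧
      ∃ E₀ : Setoid X,
        IsLeast {E : Setoid X | Hyperdef.IsTypeDefinableRel L E ∧ Hyperdef.IsStable L κ E} E₀) := by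
  refine ⟨fun α β hα hβ X Y E F hE hF hsE hsF => ⟨hE.prodRel hF,
    Hyperdef.IsStable.prodRel hκ hsat hhom hE hF hsE hsF hα hβ⟩, fun α hα X hX => ?_⟩
  have h (S : Set (Setoid X))
      (hS : ∀ E ∈ S, Hyperdef.IsTypeDefinableRel L E ∧ Hyperdef.IsStable L κ E) :
      Hyperdef.IsTypeDefinableRel L (sInf S) ∧ Hyperdef.IsStable L κ (sInf S) :=
    ⟨Hyperdef.isTypeDefinableRel_sInf fun E hE => (hS E hE).1,
      Hyperdef.isStable_sInf hκ hsat hhom hX hα S hS⟩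
  exact ⟨h, sInf {E | Hyperdef.IsTypeDefinableRel L E ∧ Hyperdef.IsStable L κ E},
    h _ fun _ hE => hE, fun _ hE => sInf_le hE⟩
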